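/- Let $A$ and $B$ be lattices with unit (greatest element). For $a\in A$, $b\in B$ put $a\mathbin{\square}b=\{(x,y)\in A\times B : x\le a\text{ or }y\le b\}$, and let the box product $A\mathbin{\square}B$ be the set of all intersections of finite nonempty families of such sets, ordered by inclusion; it is a lattice, with intersection as meet. For a lattice $L$, let $\mathrm{Con}_c L$ be the join-semilattice with zero of compact congruences of $L$, and let $\Theta_L(x,y)$ be the least congruence of $L$ identifying $x$ and $y$. For join-semilattices $S,T$ with zero, a bi-ideal of $S\times T$ is a hereditary (lower) subset that contains all pairs $(0,t)$ and $(s,0)$ and is closed under $(s_0,t),(s_1,t)\mapsto(s_0\vee s_1,t)$ and $(s,t_0),(s,t_1)\mapsto(s,t_0\vee t_1)$; the tensor product $S\otimes T$ is the join-semilattice with zero of compact elements of the lattice of bi-ideals of $S\times T$ ordered by inclusion, and $s\otimes t\in S\otimes T$ is the least bi-ideal containing $(s,t)$. Then there exists a unique isomorphism $\mu$ from $\mathrm{Con}_c A\otimes\mathrm{Con}_c B$ onto $\mathrm{Con}_c(A\mathbin{\square}B)$ such that \[ \mu\bigl(\Theta_A(a_0,a_1)\otimes\Theta_B(b_0,b_1)\bigr)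 =\Theta_{A\mathbin{\square}B}\bigl(a_0\mathbin{\square}b_0,\ (a_0\mathbin{\square}b_1)\cap(a_1\mathbin{\square}b_0)\bigr) \] for all $a_0\le a_1$ in $A$ and all $b_0\le b_1$ in $B$. -/

import Mathlib

/- ### Congruences of a lattice -/

namespace LatticeCon

variable {L : Type*} [Lattice L]

theorem ext_rel {c d : LatticeCon L} (h : ∀ x y, c.r x y ↔ d.r x y) : c = d := by
  rcases c with ⟨c, _, _⟩
  rcases d with ⟨d, _, _⟩
  have : c = d := Setoid.ext h
  subst this
  rfl

/-- Congruences are ordered by containment (as sets of pairs). -/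
instance instPartialOrder : PartialOrder (LatticeCon L) where
  le c d := ∀ ⦃x y : L⦄, c.r x y → d.r x y
  le_refl _ _ _ h := h
  le_trans _ _ _ h₁ h₂ _ _ h := h₂ (h₁ h)
  le_antisymm _ _ h₁ h₂ := ext_rel fun _ _ => ⟨fun h => h₁ h, fun h => h₂ h⟩

theorem le_def {c d : LatticeCon L} : c ≤ d ↔ ∀ ⦃x y : L⦄, c.r x y → d.r x y := Iff.rfl

/-- The infimum of a set of congruences is its intersection. -/
instance instInfSet : InfSet (LatticeCon L) where
  sInf S :=
    { r := fun x y => ∀ c ∈ S, c.r x y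
      iseqv := ⟨fun x c _ => c.refl x, fun h c hc => c.symm (h c hc),
        fun h₁ h₂ c hc => c.trans (h₁ c hc) (h₂ c hc)⟩
      inf := fun h₁ h₂ c hc => c.inf (h₁ c hc) (h₂ c hc)
      sup := fun h₁ h₂ c hc => c.sup (h₁ c hc) (h₂ c hc) }

theorem sInf_rel {S : Set (LatticeCon L)} {x y : L} :
    (sInf S).r x y ↔ ∀ c ∈ S, c.r x y := Iff.rfl

/-- The congruence lattice of `L`. -/
instance instCompleteLattice : CompleteLattice (LatticeCon L) :=
  completeLatticeOfInf _ fun _ =>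
    ⟨fun c hc _ _ h => h c hc, fun _ hd _ _ h _ hc => hd hc h⟩

/-- The union of a nonempty directed set of congruences. -/
def directedUnion (S : Set (LatticeCon L)) (hne : S.Nonempty) (hS : DirectedOn (· ≤ ·) S) :
    LatticeCon L where
  r x y := ∃ c ∈ S, c.r x y
  iseqv := by
    refine ⟨fun x => ?_, ?_, ?_⟩
    · obtain ⟨c, hc⟩ := hne
      exact ⟨c, hc, c.refl x⟩
    · rintro x y ⟨c, hc, h⟩
      exact ⟨c, hc, c.symm h⟩
    · rintro x y z ⟨c, hc, h⟩ ⟨d, hd, h'⟩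
      obtain ⟨e, he, hce, hde⟩ := hS c hc d hd
      exact ⟨e, he, e.trans (hce h) (hde h')⟩
  inf := by
    rintro w x y z ⟨c, hc, h⟩ ⟨d, hd, h'⟩
    obtain ⟨e, he, hce, hde⟩ := hS c hc d hd
    exact ⟨e, he, e.inf (hce h) (hde h')⟩
  sup := by
    rintro w x y z ⟨c, hc, h⟩ ⟨d, hd, h'⟩
    obtain ⟨e, he, hce, hde⟩ := hS c hc d hd
    exact ⟨e, he, e.sup (hce h) (hde h')⟩

/-- The principal congruence `Θ_L(a, b)`: the least congruence of `L` that identifies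
`a` and `b`. -/
def principal (a b : L) : LatticeCon L := sInf {c | c.r a b}

theorem principal_rel (a b : L) : (principal a b).r a b := fun _ hc => hc

theorem principal_le {a b : L} {c : LatticeCon L} : principal a b ≤ c ↔ c.r a b :=
  ⟨fun h => h (principal_rel a b), fun h _ _ h' => h' c h⟩

theorem principal_isCompactElement (a b : L) : IsCompactElement (principal a b) := by
  intro S u hne hdir hu hle
  have h : u ≤ directedUnion S hne hdir := hu.2 fun c hc _ _ h => ⟨c, hc, h⟩
  obtain ⟨c, hc, hab⟩ := h (principal_le.1 hle)
  exact ⟨c, hc, principal_le.2 hab⟩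

end LatticeCon

/- ### Compact elements and tensor products of join-semilattices with zero -/

/-- The compact elements of a complete lattice, with the induced order. -/
def CompactElements (α : Type*) [CompleteLattice α] : Type _ := {k : α // IsCompactElement k}

namespace CompactElements

variable {α : Type*} [CompleteLattice α]

/-- The compact elements form a join-subsemilattice: their joins are those of `α`. -/
instance instSemilatticeSup : SemilatticeSup (CompactElements α) :=
  Subtype.semilatticeSup fun {_ _} hx hy S u hne hdir hu hle => by
    obtain ⟨c, hc, hxc⟩ := hx S u hne hdir hu (le_sup_left.trans hle)
    obtain ⟨d, hd, hyd⟩ := hy S u hne hdir hu (le_sup_right.trans hle)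
    obtain ⟨e, he, hce, hde⟩ := hdir c hc d hd
    exact ⟨e, he, sup_le (hxc.trans hce) (hyd.trans hde)⟩

/-- The zero of the compact elements is the zero of `α`. -/
instance instOrderBot : OrderBot (CompactElements α) :=
  Subtype.orderBot fun _ _ hne _ _ _ => hne.imp fun _ hx => ⟨hx, bot_le⟩

end CompactElements

/-- `Con_c L`: the join-semilattice with zero of compact congruences of the lattice `L`. -/
abbrev Conc (L : Type*) [Lattice L] : Type _ := CompactElements (LatticeCon L)

/-- The principal congruence `Θ_L(a, b)` as an element of `Con_c L`. -/
def Conc.principal {L : Type*} [Lattice L] (a b : L) : Conc L :=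
  ⟨LatticeCon.principal a b, LatticeCon.principal_isCompactElement a b⟩

/-- A bi-ideal of `S × T`, for join-semilattices `S` and `T` with zero: a hereditary subset that
contains all the pairs with a zero entry and is closed under joins in either coordinate. -/
@[ext]
structure BiIdeal (S T : Type*) [SemilatticeSup S] [OrderBot S] [SemilatticeSup T] [OrderBot T] where
  carrier : Set (S × T)
  bot_left_mem : ∀ t : T, (⊥, t) ∈ carrier
  bot_right_mem : ∀ s : S, (s, ⊥) ∈ carrier
  lower : IsLowerSet carrier
  sup_left_mem : ∀ {s₀ s₁ : S} {t : T},
    (s₀, t) ∈ carrier → (s₁, t) ∈ carrier → (s₀ ⊔ s₁, t) ∈ carrier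
  sup_right_mem : ∀ {s : S} {t₀ t₁ : T},
    (s, t₀) ∈ carrier → (s, t₁) ∈ carrier → (s, t₀ ⊔ t₁) ∈ carrier

namespace BiIdeal

variable {S T : Type*} [SemilatticeSup S] [OrderBot S] [SemilatticeSup T] [OrderBot T]

/-- Bi-ideals are ordered by containment. -/
instance instPartialOrder : PartialOrder (BiIdeal S T) :=
  PartialOrder.lift BiIdeal.carrier fun _ _ h => BiIdeal.ext h

theorem le_def {I J : BiIdeal S T} : I ≤ J ↔ I.carrier ⊆ J.carrier := Iff.rfl

/-- The infimum of a set of bi-ideals is its intersection. -/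
instance instInfSet : InfSet (BiIdeal S T) where
  sInf F :=
    { carrier := {p | ∀ I ∈ F, p ∈ I.carrier}
      bot_left_mem := fun t I _ => I.bot_left_mem t
      bot_right_mem := fun s I _ => I.bot_right_mem s
      lower := fun _ _ hle h I hI => I.lower hle (h I hI)
      sup_left_mem := fun h₀ h₁ I hI => I.sup_left_mem (h₀ I hI) (h₁ I hI)
      sup_right_mem := fun h₀ h₁ I hI => I.sup_right_mem (h₀ I hI) (h₁ I hI) }

/-- The extended tensor product of `S` and `T`: the complete lattice of bi-ideals of `S × T`. -/
instance instCompleteLattice : CompleteLattice (BiIdeal S T) :=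
  completeLatticeOfInf _ fun _ =>
    ⟨fun I hI _ hp => hp I hI, fun _ hJ _ hp _ hI => hJ hI hp⟩

/-- The union of a nonempty directed set of bi-ideals. -/
def directedUnion (F : Set (BiIdeal S T)) (hne : F.Nonempty) (hF : DirectedOn (· ≤ ·) F) :
    BiIdeal S T where
  carrier := {p | ∃ I ∈ F, p ∈ I.carrier}
  bot_left_mem t := hne.imp fun I hI => ⟨hI, I.bot_left_mem t⟩
  bot_right_mem s := hne.imp fun I hI => ⟨hI, I.bot_right_mem s⟩
  lower := by
    rintro p q hle ⟨I, hI, h⟩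
    exact ⟨I, hI, I.lower hle h⟩
  sup_left_mem := by
    rintro s₀ s₁ t ⟨I, hI, h₀⟩ ⟨J, hJ, h₁⟩
    obtain ⟨K, hK, hIK, hJK⟩ := hF I hI J hJ
    exact ⟨K, hK, K.sup_left_mem (hIK h₀) (hJK h₁)⟩
  sup_right_mem := by
    rintro s t₀ t₁ ⟨I, hI, h₀⟩ ⟨J, hJ, h₁⟩
    obtain ⟨K, hK, hIK, hJK⟩ := hF I hI J hJ
    exact ⟨K, hK, K.sup_right_mem (hIK h₀) (hJK h₁)⟩

/-- The pure tensor `s ⊗ t`: all pairs below `(s, t)`, and all pairs with a zero entry. -/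
def pure (s : S) (t : T) : BiIdeal S T where
  carrier := {p | (p.1 ≤ s ∧ p.2 ≤ t) ∨ p.1 = ⊥ ∨ p.2 = ⊥}
  bot_left_mem _ := Or.inr (Or.inl rfl)
  bot_right_mem _ := Or.inr (Or.inr rfl)
  lower := by
    rintro ⟨x, y⟩ ⟨x', y'⟩ ⟨hx, hy⟩ (⟨h₁, h₂⟩ | h | h)
    · exact Or.inl ⟨le_trans hx h₁, le_trans hy h₂⟩
    · exact Or.inr (Or.inl (le_bot_iff.1 (hx.trans h.le)))
    · exact Or.inr (Or.inr (le_bot_iff.1 (hy.trans h.le)))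
  sup_left_mem := by
    rintro s₀ s₁ y (⟨h₁, h₂⟩ | h | h) (⟨h₃, h₄⟩ | h' | h') <;> simp_all
  sup_right_mem := by
    rintro x t₀ t₁ (⟨h₁, h₂⟩ | h | h) (⟨h₃, h₄⟩ | h' | h') <;> simp_all

theorem pure_le {s : S} {t : T} {I : BiIdeal S T} : pure s t ≤ I ↔ (s, t) ∈ I.carrier := by
  refine ⟨fun h => h (Or.inl ⟨le_rfl, le_rfl⟩), ?_⟩
  rintro h ⟨x, y⟩ (⟨h₁, h₂⟩ | h' | h')
  · exact I.lower (Prod.mk_le_mk.2 ⟨h₁, h₂⟩) h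
  · obtain rfl : x = ⊥ := h'
    exact I.bot_left_mem y
  · obtain rfl : y = ⊥ := h'
    exact I.bot_right_mem x

theorem pure_isCompactElement (s : S) (t : T) : IsCompactElement (pure s t) := by
  intro F u hne hdir hu hle
  have h : u ≤ directedUnion F hne hdir := hu.2 fun I hI _ h => ⟨I, hI, h⟩
  obtain ⟨I, hI, hst⟩ := h (pure_le.1 hle)
  exact ⟨I, hI, pure_le.2 hst⟩

end BiIdeal

/-- The tensor product `S ⊗ T` of join-semilattices with zero: the join-semilattice with zero
of compact elements of the lattice of bi-ideals of `S × T`. -/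
abbrev SemilatticeTensor (S T : Type*) [SemilatticeSup S] [OrderBot S] [SemilatticeSup T]
    [OrderBot T] : Type _ :=
  CompactElements (BiIdeal S T)

/-- The pure tensor `s ⊗ t` as an element of `S ⊗ T`. -/
def SemilatticeTensor.tmul {S T : Type*} [SemilatticeSup S] [OrderBot S] [SemilatticeSup T]
    [OrderBot T] (s : S) (t : T) : SemilatticeTensor S T :=
  ⟨BiIdeal.pure s t, BiIdeal.pure_isCompactElement s t⟩

/- ### The box product of two lattices -/

/-- The pure box `a □ b`, as a subset of `A × B`. -/
def pureBox {A B : Type*} [Lattice A] [Lattice B] (a : A) (b : B) : Set (A × B) :=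
  {p | p.1 ≤ a ∨ p.2 ≤ b}

/-- The box product `A □ B`: the set of all finite nonempty intersections of pure boxes. -/
def BoxProduct (A B : Type*) [Lattice A] [Lattice B] : Type _ :=
  {H : Set (A × B) // ∃ s : Finset (A × B), s.Nonempty ∧ H = ⋂ p ∈ s, pureBox p.1 p.2}

namespace BoxProduct

variable {A B : Type*} [Lattice A] [Lattice B]

/-- The box product is ordered by containment. -/
instance instPartialOrder : PartialOrder (BoxProduct A B) := Subtype.partialOrder _

/-- The pure box `a □ b` as an element of `A □ B`. -/
def box (a : A) (b : B) : BoxProduct A B :=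
  ⟨pureBox a b, {(a, b)}, Finset.singleton_nonempty _, by simp⟩

theorem pureBox_mono {a a' : A} {b b' : B} (ha : a ≤ a') (hb : b ≤ b') :
    pureBox a b ⊆ pureBox a' b' := by
  rintro ⟨x, y⟩ (h | h)
  · exact Or.inl (le_trans h ha)
  · exact Or.inr (le_trans h hb)

/-- The box closure of a subset of `A × B`: the intersection of all pure boxes containing it. -/
def boxClosure (X : Set (A × B)) : Set (A × B) :=
  {p | ∀ (a : A) (b : B), X ⊆ pureBox a b → p ∈ pureBox a b}

theorem subset_boxClosure (X : Set (A × B)) : X ⊆ boxClosure X :=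
  fun _ hp _ _ h => h hp

theorem exists_of_subset_pureBox {s : Finset (A × B)} (hs : s.Nonempty) {a : A} {b : B}
    (ha : ∃ x, ¬ x ≤ a) (hb : ∃ y, ¬ y ≤ b)
    (h : (⋂ p ∈ s, pureBox p.1 p.2) ⊆ pureBox a b) :
    (∃ m ∈ infClosure (Prod.fst '' (s : Set (A × B))), m ≤ a) ∧
    (∃ m ∈ infClosure (Prod.snd '' (s : Set (A × B))), m ≤ b) ∧
    ∀ q ∈ ⋂ p ∈ s, pureBox p.1 p.2,
      (∃ m ∈ infClosure (Prod.fst '' (s : Set (A × B))), q.1 ≤ m ∧ m ≤ a) ∨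
      (∃ m ∈ infClosure (Prod.snd '' (s : Set (A × B))), q.2 ≤ m ∧ m ≤ b) := by
  classical
  have hA : ∀ (u : Finset (A × B)) (hu : u.Nonempty), u ⊆ s →
      u.inf' hu Prod.fst ∈ infClosure (Prod.fst '' (s : Set (A × B))) := fun u hu hus =>
    finsetInf'_mem_infClosure hu fun p hp => ⟨p, hus hp, rfl⟩
  have hB : ∀ (u : Finset (A × B)) (hu : u.Nonempty), u ⊆ s →
      u.inf' hu Prod.snd ∈ infClosure (Prod.snd '' (s : Set (A × B))) := fun u hu hus =>
    finsetInf'_mem_infClosure hu fun p hp => ⟨p, hus hp, rfl⟩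
  have h₁ : s.inf' hs Prod.fst ≤ a := by
    obtain ⟨y, hy⟩ := hb
    have : (s.inf' hs Prod.fst, y) ∈ pureBox a b := h <| by
      simp only [Set.mem_iInter]
      exact fun p hp => Or.inl (Finset.inf'_le _ hp)
    exact this.resolve_right hy
  have h₂ : s.inf' hs Prod.snd ≤ b := by
    obtain ⟨x, hx⟩ := ha
    have : (x, s.inf' hs Prod.snd) ∈ pureBox a b := h <| by
      simp only [Set.mem_iInter]
      exact fun p hp => Or.inr (Finset.inf'_le _ hp)
    exact this.resolve_left hx
  refine ⟨⟨_, hA s hs subset_rfl, h₁⟩, ⟨_, hB s hs subset_rfl, h₂⟩, fun q hq => ?_⟩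
  simp only [Set.mem_iInter] at hq
  by_cases hu : (s.filter fun p => q.1 ≤ p.1).Nonempty
  · by_cases hv : (s.filter fun p => ¬ q.1 ≤ p.1).Nonempty
    · have : ((s.filter fun p => q.1 ≤ p.1).inf' hu Prod.fst,
          (s.filter fun p => ¬ q.1 ≤ p.1).inf' hv Prod.snd) ∈ pureBox a b := h <| by
        simp only [Set.mem_iInter]
        intro p hp
        by_cases hqp : q.1 ≤ p.1
        · exact Or.inl (Finset.inf'_le _ (Finset.mem_filter.2 ⟨hp, hqp⟩))
        · exact Or.inr (Finset.inf'_le _ (Finset.mem_filter.2 ⟨hp, hqp⟩))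
      rcases this with this | this
      · refine Or.inl ⟨_, hA _ hu (Finset.filter_subset _ _), ?_, this⟩
        exact Finset.le_inf' _ _ fun p hp => (Finset.mem_filter.1 hp).2
      · refine Or.inr ⟨_, hB _ hv (Finset.filter_subset _ _), ?_, this⟩
        refine Finset.le_inf' _ _ fun p hp => ?_
        exact (hq p (Finset.mem_filter.1 hp).1).resolve_left (Finset.mem_filter.1 hp).2
    · refine Or.inl ⟨_, hA s hs subset_rfl, Finset.le_inf' _ _ fun p hp => ?_, h₁⟩
      by_contra hqp
      exact hv ⟨p, Finset.mem_filter.2 ⟨hp, hqp⟩⟩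
  · refine Or.inr ⟨_, hB s hs subset_rfl, Finset.le_inf' _ _ fun p hp => ?_, h₂⟩
    exact (hq p hp).resolve_left fun hqp => hu ⟨p, Finset.mem_filter.2 ⟨hp, hqp⟩⟩

/-- The box closure of the union of two elements of `A □ B` belongs to `A □ B`. -/
theorem boxClosure_union_mem (H K : BoxProduct A B) :
    ∃ s : Finset (A × B), s.Nonempty ∧
      boxClosure (H.1 ∪ K.1) = ⋂ p ∈ s, pureBox p.1 p.2 := by
  classical
  obtain ⟨_, s, hs, rfl⟩ := H
  obtain ⟨_, t, ht, rfl⟩ := K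
  set X : Set (A × B) := (⋂ p ∈ s, pureBox p.1 p.2) ∪ ⋂ p ∈ t, pureBox p.1 p.2 with hX
  set M : Set A := infClosure (Prod.fst '' ((s ∪ t : Finset (A × B)) : Set (A × B))) with hM
  set N : Set B := infClosure (Prod.snd '' ((s ∪ t : Finset (A × B)) : Set (A × B))) with hN
  have hMf : M.Finite := ((s ∪ t).finite_toSet.image _).infClosure
  have hNf : N.Finite := ((s ∪ t).finite_toSet.image _).infClosure
  have hsM : infClosure (Prod.fst '' (s : Set (A × B))) ⊆ M :=
    infClosure_mono (Set.image_mono (by simp))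
  have htM : infClosure (Prod.fst '' (t : Set (A × B))) ⊆ M :=
    infClosure_mono (Set.image_mono (by simp))
  have hsN : infClosure (Prod.snd '' (s : Set (A × B))) ⊆ N :=
    infClosure_mono (Set.image_mono (by simp))
  have htN : infClosure (Prod.snd '' (t : Set (A × B))) ⊆ N :=
    infClosure_mono (Set.image_mono (by simp))
  have key : ∀ a b, (∃ x, ¬ x ≤ a) → (∃ y, ¬ y ≤ b) → X ⊆ pureBox a b →
      ∃ u ∈ supClosure M, ∃ v ∈ supClosure N, u ≤ a ∧ v ≤ b ∧ X ⊆ pureBox u v := by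
    intro a b ha hb hXab
    obtain ⟨⟨m, hm, hma⟩, ⟨n, hn, hnb⟩, h₁⟩ :=
      exists_of_subset_pureBox hs ha hb (Set.subset_union_left.trans hXab)
    obtain ⟨-, -, h₂⟩ := exists_of_subset_pureBox ht ha hb (Set.subset_union_right.trans hXab)
    have hu : (hMf.toFinset.filter (· ≤ a)).Nonempty := ⟨m, by simp [hsM hm, hma]⟩
    have hv : (hNf.toFinset.filter (· ≤ b)).Nonempty := ⟨n, by simp [hsN hn, hnb]⟩
    refine ⟨_, finsetSup'_mem_supClosure (f := id) hu (by simp +contextual),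
      _, finsetSup'_mem_supClosure (f := id) hv (by simp +contextual),
      Finset.sup'_le _ _ (by simp), Finset.sup'_le _ _ (by simp), ?_⟩
    have hMu : ∀ x, (∃ m ∈ M, x ≤ m ∧ m ≤ a) →
        x ≤ (hMf.toFinset.filter (· ≤ a)).sup' hu id := by
      rintro x ⟨m, hm, hxm, hma⟩
      exact hxm.trans (Finset.le_sup' id (by simp [hm, hma]))
    have hNv : ∀ y, (∃ n ∈ N, y ≤ n ∧ n ≤ b) →
        y ≤ (hNf.toFinset.filter (· ≤ b)).sup' hv id := by
      rintro x ⟨m, hm, hxm, hma⟩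
      exact hxm.trans (Finset.le_sup' id (by simp [hm, hma]))
    rintro q (hq | hq)
    · exact (h₁ q hq).imp (fun ⟨m, hm, h⟩ => hMu _ ⟨m, hsM hm, h⟩)
        (fun ⟨m, hm, h⟩ => hNv _ ⟨m, hsN hm, h⟩)
    · exact (h₂ q hq).imp (fun ⟨m, hm, h⟩ => hMu _ ⟨m, htM hm, h⟩)
        (fun ⟨m, hm, h⟩ => hNv _ ⟨m, htN hm, h⟩)
  obtain ⟨p, hp⟩ := hs
  obtain ⟨q, hq⟩ := ht
  have hF : {r : A × B | r.1 ∈ supClosure M ∧ r.2 ∈ supClosure N ∧ X ⊆ pureBox r.1 r.2}.Finite :=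
    (hMf.supClosure.prod hNf.supClosure).subset fun r hr => ⟨hr.1, hr.2.1⟩
  refine ⟨insert (p.1 ⊔ q.1, p.2 ⊔ q.2) hF.toFinset, Finset.insert_nonempty _ _, ?_⟩
  have hpq : X ⊆ pureBox (p.1 ⊔ q.1) (p.2 ⊔ q.2) := by
    rintro z (hz | hz) <;> simp only [Set.mem_iInter] at hz
    · exact pureBox_mono le_sup_left le_sup_left (hz p hp)
    · exact pureBox_mono le_sup_right le_sup_right (hz q hq)
  ext z
  simp only [Set.mem_iInter]
  constructor
  · intro hz r hr
    rcases Finset.mem_insert.1 hr with rfl | hr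
    · exact hz _ _ hpq
    · exact hz _ _ ((hF.mem_toFinset.1 hr).2.2)
  · intro hz a b hab
    by_cases ha : ∃ x, ¬ x ≤ a
    · by_cases hb : ∃ y, ¬ y ≤ b
      · obtain ⟨u, hu, v, hv, hua, hvb, h⟩ := key a b ha hb hab
        exact pureBox_mono hua hvb
          (hz (u, v) (Finset.mem_insert_of_mem (hF.mem_toFinset.2 ⟨hu, hv, h⟩)))
      · push Not at hb
        exact Or.inr (hb _)
    · push Not at ha
      exact Or.inl (ha _)

/-- The box product is a lattice: the meet of two elements is their intersection, and their join
is the box closure of their union. -/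
instance instLattice : Lattice (BoxProduct A B) where
  sup H K := ⟨boxClosure (H.1 ∪ K.1), boxClosure_union_mem H K⟩
  le_sup_left _ _ := Set.subset_union_left.trans (subset_boxClosure _)
  le_sup_right _ _ := Set.subset_union_right.trans (subset_boxClosure _)
  sup_le := by
    rintro H K ⟨_, s, hs, rfl⟩ hH hK q hq
    simp only [Set.mem_iInter]
    intro p hp
    refine hq _ _ ?_
    have h : (⋂ p ∈ s, pureBox p.1 p.2) ⊆ pureBox p.1 p.2 := Set.biInter_subset_of_mem hp
    exact Set.union_subset (Set.Subset.trans hH h) (Set.Subset.trans hK h)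
  inf H K := ⟨H.1 ∩ K.1, by
    classical
    obtain ⟨_, s, hs, rfl⟩ := H
    obtain ⟨_, t, ht, rfl⟩ := K
    refine ⟨s ∪ t, hs.inl, ?_⟩
    ext z
    simp only [Set.mem_inter_iff, Set.mem_iInter, Finset.mem_union, or_imp, forall_and]⟩
  inf_le_left _ _ := Set.inter_subset_left
  inf_le_right _ _ := Set.inter_subset_right
  le_inf _ _ _ h₁ h₂ := Set.subset_inter h₁ h₂

theorem le_def {H K : BoxProduct A B} : H ≤ K ↔ H.1 ⊆ K.1 := Iff.rfl

theorem coe_inf (H K : BoxProduct A B) : (H ⊓ K).1 = H.1 ∩ K.1 := rfl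

end BoxProduct

/-! For x ≤ y and u ≤ v, call [x □ u, (x □ v) ∩ (y □ u)] an elementary interval. Send a congruence
of A □ B to the bi-ideal of those (α, β) for which it collapses every elementary interval over α and
β. This map turns out to be an isomorphism from Con(A □ B) onto the lattice of all bi-ideals, and it
restricts to the compact elements.

The image is a bi-ideal because, with u and v fixed, the pairs of A that qualify form a congruence,
and symmetrically (`leftCon`, `rightCon`). The map is an embedding because the collapsed elementary
intervals determine a congruence (`toBiIdeal_le_toBiIdeal`). It is onto because congruences P of A
and Q of B induce `prodCon P Q`, which collapses an elementary interval exactly when P identifies x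
and y or Q identifies u and v; distributivity of Con B lets such pairs (P, Q) cut out any bi-ideal
(`BiIdeal.exists_separating`). The inverse sends pure tensors of principal congruences to principal
congruences. Those tensors are join-dense, which gives uniqueness. -/

/-! ### Joins and distributivity of congruences; finite congruent families -/

namespace LatticeCon

variable {L : Type*} [Lattice L]

theorem rel_of_le_of_le (c : LatticeCon L) {x y z : L} (hxy : x ≤ y) (hyz : y ≤ z)
    (h : c.r x z) : c.r x y := by
  simpa [inf_eq_left.2 hxy, inf_eq_right.2 hyz] using c.inf h (c.refl y)

theorem rel_sup_right (c : LatticeCon L) {x y : L} (h : c.r x y) (z : L) :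
    c.r (x ⊔ z) (y ⊔ z) := c.sup h (c.refl z)

theorem rel_inf_right (c : LatticeCon L) {x y : L} (h : c.r x y) (z : L) :
    c.r (x ⊓ z) (y ⊓ z) := c.inf h (c.refl z)

/-- A congruence is determined by its comparable pairs. -/
theorem le_of_forall_le {c d : LatticeCon L} (h : ∀ x y, x ≤ y → c.r x y → d.r x y) : c ≤ d :=
  fun _ _ hxy => d.r_inf_sup_iff.1 (h _ _ inf_le_sup (c.r_inf_sup_iff.2 hxy))

/-- The equivalence join of two lattice congruences is a lattice congruence. -/
def setoidSup (c d : LatticeCon L) : LatticeCon L where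
  toSetoid := c.toSetoid ⊔ d.toSetoid
  inf := by
    -- Pulled back along a translation, the equivalence join still contains `c` and `d`, hence
    -- itself. Compatibility in two variables is two such translations.
    have key : ∀ z : L, c.toSetoid ⊔ d.toSetoid ≤
        Setoid.comap (· ⊓ z) (c.toSetoid ⊔ d.toSetoid) := fun z =>
      sup_le (fun _ _ h => (le_sup_left : c.toSetoid ≤ c.toSetoid ⊔ d.toSetoid)
          (c.rel_inf_right h z))
        (fun _ _ h => (le_sup_right : d.toSetoid ≤ c.toSetoid ⊔ d.toSetoid)
          (d.rel_inf_right h z))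
    intro w x y z h₁ h₂
    refine (c.toSetoid ⊔ d.toSetoid).trans (key y h₁) ?_
    have : (c.toSetoid ⊔ d.toSetoid).r (y ⊓ x) (z ⊓ x) := key x h₂
    rwa [inf_comm y, inf_comm z] at this
  sup := by
    have key : ∀ z : L, c.toSetoid ⊔ d.toSetoid ≤
        Setoid.comap (· ⊔ z) (c.toSetoid ⊔ d.toSetoid) := fun z =>
      sup_le (fun _ _ h => (le_sup_left : c.toSetoid ≤ c.toSetoid ⊔ d.toSetoid)
          (c.rel_sup_right h z))
        (fun _ _ h => (le_sup_right : d.toSetoid ≤ c.toSetoid ⊔ d.toSetoid)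
          (d.rel_sup_right h z))
    intro w x y z h₁ h₂
    refine (c.toSetoid ⊔ d.toSetoid).trans (key y h₁) ?_
    have : (c.toSetoid ⊔ d.toSetoid).r (y ⊔ x) (z ⊔ x) := key x h₂
    rwa [sup_comm y, sup_comm z] at this

/-- An equivalence relation containing two congruences contains their join. -/
theorem sup_rel_le {c d : LatticeCon L} {s : Setoid L} (hc : c.toSetoid ≤ s) (hd : d.toSetoid ≤ s)
    {x y : L} (h : (c ⊔ d).r x y) : s.r x y := by
  have h₁ : c ⊔ d ≤ setoidSup c d := sup_le
    (fun _ _ h => (le_sup_left : c.toSetoid ≤ c.toSetoid ⊔ d.toSetoid) h)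
    (fun _ _ h => (le_sup_right : d.toSetoid ≤ c.toSetoid ⊔ d.toSetoid) h)
  exact (sup_le hc hd : c.toSetoid ⊔ d.toSetoid ≤ s) (h₁ h)

/-- The majority term of lattices. -/
def majority (x y z : L) : L := ((x ⊓ y) ⊔ (y ⊓ z)) ⊔ (z ⊓ x)

theorem majority_left (x y : L) : majority x y x = x := by
  simp only [majority, inf_idem, inf_comm y x, sup_idem]
  exact sup_eq_right.2 inf_le_left

theorem majority_right (x y : L) : majority x y y = y := by
  simp only [majority, inf_idem, inf_comm y x]
  rw [sup_eq_right.2 (inf_le_right : x ⊓ y ≤ y), sup_eq_left.2 inf_le_right]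

theorem majority_self (x z : L) : majority x x z = x := by
  simp only [majority, inf_idem, inf_comm z x]
  rw [sup_eq_left.2 (inf_le_left : x ⊓ z ≤ x), sup_eq_left.2 inf_le_left]

theorem majority_rel (c : LatticeCon L) {x x' y y' z z' : L} (hx : c.r x x') (hy : c.r y y')
    (hz : c.r z z') : c.r (majority x y z) (majority x' y' z') :=
  c.sup (c.sup (c.inf hx hy) (c.inf hy hz)) (c.inf hz hx)

/-- The congruence lattice of a lattice is distributive. -/
theorem inf_sup_le_of_le {e c d f : LatticeCon L} (hc : e ⊓ c ≤ f) (hd : e ⊓ d ≤ f) :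
    e ⊓ (c ⊔ d) ≤ f := by
  -- Jónsson's argument: `s` is only an equivalence relation, but it contains `c` and `d`, hence `c
  -- ⊔ d`. Taking `a = x`, `b = y` then recovers `f.r x y` from the majority identities.
  let s : Setoid L :=
    { r := fun x y => ∀ a b, e.r a b → f.r (majority a b x) (majority a b y)
      iseqv := ⟨fun _ _ _ _ => f.refl _, fun h a b hab => f.symm (h a b hab),
        fun h h' a b hab => f.trans (h a b hab) (h' a b hab)⟩ }
  have key : ∀ g : LatticeCon L, e ⊓ g ≤ f → g.toSetoid ≤ s := by
    intro g hg x y hxy a b hab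
    refine hg ?_
    have h₁ : e.r (majority a b x) (majority a b y) := by
      have h : ∀ z, e.r (majority a b z) a := fun z => by
        have := e.majority_rel (e.refl a) (e.symm hab) (e.refl z)
        rwa [majority_self] at this
      exact e.trans (h x) (e.symm (h y))
    have h₂ : g.r (majority a b x) (majority a b y) :=
      g.majority_rel (g.refl a) (g.refl b) hxy
    have : (principal (majority a b x) (majority a b y)) ≤ e ⊓ g :=
      le_inf (principal_le.2 h₁) (principal_le.2 h₂)
    exact principal_le.1 this
  intro x y hxy
  have he : e.r x y := (inf_le_left : e ⊓ (c ⊔ d) ≤ e) hxy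
  have hs : s.r x y := sup_rel_le (key c hc) (key d hd) ((inf_le_right : e ⊓ (c ⊔ d) ≤ _) hxy)
  have := hs x y he
  rwa [majority_left, majority_right] at this

theorem sup'_rel {ι : Type*} (c : LatticeCon L) {s : Finset ι} (hs : s.Nonempty)
    {f g : ι → L} (h : ∀ i ∈ s, c.r (f i) (g i)) : c.r (s.sup' hs f) (s.sup' hs g) := by
  classical
  induction hs using Finset.Nonempty.cons_induction with
  | singleton i => simpa using h i (by simp)
  | cons i s hi hs ih =>
    rw [Finset.sup'_cons hs, Finset.sup'_cons hs]
    exact c.sup (h i (by simp)) (ih fun j hj => h j (by simp [hj]))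

theorem inf'_rel {ι : Type*} (c : LatticeCon L) {s : Finset ι} (hs : s.Nonempty)
    {f g : ι → L} (h : ∀ i ∈ s, c.r (f i) (g i)) : c.r (s.inf' hs f) (s.inf' hs g) := by
  classical
  induction hs using Finset.Nonempty.cons_induction with
  | singleton i => simpa using h i (by simp)
  | cons i s hi hs ih =>
    rw [Finset.inf'_cons hs, Finset.inf'_cons hs]
    exact c.inf (h i (by simp)) (ih fun j hj => h j (by simp [hj]))

theorem inf_rel {ι : Type*} [OrderTop L] (c : LatticeCon L) (s : Finset ι)
    {f g : ι → L} (h : ∀ i ∈ s, c.r (f i) (g i)) : c.r (s.inf f) (s.inf g) := by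
  classical
  induction s using Finset.induction_on with
  | empty => exact c.refl _
  | insert i s hi ih =>
    rw [Finset.inf_insert, Finset.inf_insert]
    exact c.inf (h i (by simp)) (ih fun j hj => h j (by simp [hj]))

/-- For finite congruent families `f` and `g`, every `x` is congruent to some `x'` that bounds
`g i` whenever `x` bounds `f i`. -/
theorem exists_rel_le {ι : Type*} (c : LatticeCon L) (s : Finset ι) (f g : ι → L)
    (h : ∀ i ∈ s, c.r (g i) (f i)) (x : L) :
    ∃ x', c.r x' x ∧ ∀ i ∈ s, f i ≤ x → g i ≤ x' := by
  classical
  induction s using Finset.induction_on with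
  | empty => exact ⟨x, c.refl _, by simp⟩
  | insert i s hi ih =>
    obtain ⟨x', hx', hle⟩ := ih fun j hj => h j (by simp [hj])
    -- Only an index with `f i ≤ x` forces a change, and then `g i ⊔ x'` is congruent to `f i ⊔ x =
    -- x`.
    by_cases hi : f i ≤ x
    · refine ⟨g i ⊔ x', ?_, ?_⟩
      · simpa [sup_eq_right.2 hi] using c.sup (h i (by simp)) hx'
      · intro j hj hjx
        rcases Finset.mem_insert.1 hj with rfl | hj
        · exact le_sup_left
        · exact le_sup_of_le_right (hle j hj hjx)
    · refine ⟨x', hx', fun j hj hjx => ?_⟩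
      rcases Finset.mem_insert.1 hj with rfl | hj
      · exact absurd hjx hi
      · exact hle j hj hjx

end LatticeCon

/-! ### Ideals of compact congruences and separation of bi-ideals -/

/-- A compact element below the join of an ideal of compact elements belongs to the ideal. -/
theorem CompactElements.mem_of_le_sSup {α : Type*} [CompleteLattice α]
    {J : Set (CompactElements α)} (hlow : IsLowerSet J) (hbot : ⊥ ∈ J)
    (hsup : ∀ {x y}, x ∈ J → y ∈ J → x ⊔ y ∈ J) {k : CompactElements α}
    (h : k.1 ≤ sSup ((fun x : CompactElements α => x.1) '' J)) : k ∈ J := by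
  obtain ⟨_, ⟨x, hx, rfl⟩, hle⟩ := k.2 ((fun x : CompactElements α => x.1) '' J)
    (sSup ((fun x : CompactElements α => x.1) '' J)) ⟨_, ⊥, hbot, rfl⟩
    (by
      rintro _ ⟨x, hx, rfl⟩ _ ⟨y, hy, rfl⟩
      exact ⟨_, ⟨x ⊔ y, hsup hx hy, rfl⟩, (le_sup_left : x ≤ x ⊔ y), (le_sup_right : y ≤ x ⊔ y)⟩)
    (isLUB_sSup _) h
  exact hlow (show k ≤ x from hle) hx

/-- An ideal of `Con_c L` containing all principal congruences below `α` contains `α`. -/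
theorem Conc.mem_of_forall_principal_mem {L : Type*} [Lattice L] {J : Set (Conc L)}
    (hlow : IsLowerSet J) (hbot : ⊥ ∈ J) (hsup : ∀ {x y}, x ∈ J → y ∈ J → x ⊔ y ∈ J)
    {α : Conc L} (h : ∀ x y, x ≤ y → α.1.r x y → Conc.principal x y ∈ J) : α ∈ J :=
  CompactElements.mem_of_le_sSup (J := J) hlow hbot hsup <| LatticeCon.le_of_forall_le
    fun x y hxy hr => LatticeCon.principal_le.1 <|
      le_sSup (Set.mem_image_of_mem (fun x : Conc L => x.1) (h x y hxy hr))

namespace BiIdeal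

variable {A B : Type*} [Lattice A] [Lattice B]

/-- A bi-ideal of `Con_c A × Con_c B` is determined by its pairs of principal congruences. -/
theorem le_of_forall_principal {I J : BiIdeal (Conc A) (Conc B)}
    (h : ∀ (x y : A) (u v : B), x ≤ y → u ≤ v →
      (Conc.principal x y, Conc.principal u v) ∈ I.carrier →
        (Conc.principal x y, Conc.principal u v) ∈ J.carrier) : I ≤ J := by
  rintro ⟨α, β⟩ hαβ
  refine Conc.mem_of_forall_principal_mem (J := {γ | (γ, β) ∈ J.carrier})
    (fun _ _ hle h => J.lower (Prod.mk_le_mk.2 ⟨hle, le_rfl⟩) h) (J.bot_left_mem _)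
    J.sup_left_mem fun x y hxy hr => ?_
  refine Conc.mem_of_forall_principal_mem
    (J := {δ : Conc B | (Conc.principal x y, δ) ∈ J.carrier})
    (fun _ _ hle h => J.lower (Prod.mk_le_mk.2 ⟨le_rfl, hle⟩) h) (J.bot_right_mem _)
    J.sup_right_mem fun u v huv hr' => ?_
  exact h _ _ _ _ hxy huv (I.lower (Prod.mk_le_mk.2
    ⟨LatticeCon.principal_le.2 hr, LatticeCon.principal_le.2 hr'⟩) hαβ)

/-- A pair outside a bi-ideal is separated from it by a pair of congruences. -/
theorem exists_separating {I : BiIdeal (Conc A) (Conc B)} {γ₀ : Conc A} {δ₀ : Conc B}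
    (h₀ : (γ₀, δ₀) ∉ I.carrier) :
    ∃ (P : LatticeCon A) (Q : LatticeCon B), ¬ γ₀.1 ≤ P ∧ ¬ δ₀.1 ≤ Q ∧
      ∀ p ∈ I.carrier, p.1.1 ≤ P ∨ p.2.1 ≤ Q := by
  have hQ₀ : ¬ δ₀.1 ≤ sSup ((fun x : Conc B => x.1) '' {δ : Conc B | (γ₀, δ) ∈ I.carrier}) :=
    fun hle => h₀ <| CompactElements.mem_of_le_sSup
      (J := {δ : Conc B | (γ₀, δ) ∈ I.carrier})
      (fun _ _ hle h => I.lower (Prod.mk_le_mk.2 ⟨le_rfl, hle⟩) h) (I.bot_right_mem _)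
      I.sup_right_mem hle
  -- `Q` contains every `δ` paired with `γ₀` in `I` and is maximal not to contain `δ₀`; compactness
  -- of `δ₀` bounds the chains.
  obtain ⟨Q, hQ₀Q, hQ, hmax⟩ := zorn_le_nonempty₀ {Q : LatticeCon B | ¬ δ₀.1 ≤ Q}
    (by
      intro c hc hchain y hy
      refine ⟨sSup c, fun hle => ?_, fun z hz => le_sSup hz⟩
      obtain ⟨x, hx, hδx⟩ := δ₀.2 c (sSup c) ⟨y, hy⟩ hchain.directedOn (isLUB_sSup _) hle
      exact hc hx hδx)
    _ hQ₀
  -- By maximality, `Q` joined with any congruence not below it contains `δ₀`. Distributivity then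
  -- makes `Q` prime.
  have hprime : ∀ δ δ' : LatticeCon B, ¬ δ ≤ Q → ¬ δ' ≤ Q →
      ∃ ε : Conc B, ε.1 ≤ δ ∧ ε.1 ≤ δ' ∧ ¬ ε.1 ≤ Q := by
    intro δ δ' hδ hδ'
    have habove : ∀ ε : LatticeCon B, ¬ ε ≤ Q → δ₀.1 ≤ Q ⊔ ε := by
      intro ε hε
      by_contra hcon
      exact hε (le_sup_right.trans (hmax hcon le_sup_left))
    by_contra hcon
    push Not at hcon
    have hle : δ ⊓ δ' ≤ Q := fun x y hxy => LatticeCon.principal_le.1 <|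
      hcon (Conc.principal x y)
        (LatticeCon.principal_le.2 ((inf_le_left : δ ⊓ δ' ≤ δ) hxy))
        (LatticeCon.principal_le.2 ((inf_le_right : δ ⊓ δ' ≤ δ') hxy))
    have h₁ : δ' ⊓ (Q ⊔ δ) ≤ Q :=
      LatticeCon.inf_sup_le_of_le inf_le_right (by rwa [inf_comm])
    have h₂ : δ₀.1 ⊓ (Q ⊔ δ') ≤ Q := LatticeCon.inf_sup_le_of_le inf_le_right
      ((le_inf inf_le_right (inf_le_left.trans (habove δ hδ))).trans h₁)
    exact hQ ((le_inf le_rfl (habove δ' hδ')).trans h₂)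
  -- `P` is the join of the `γ` that `I` pairs with some `δ` outside `Q`; primeness of `Q` makes
  -- these an ideal. So `γ₀ ≤ P` would put some `(γ₀, δ)` with `δ` outside `Q` into `I`, against the
  -- choice of `Q`.
  refine ⟨sSup ((fun x : Conc A => x.1) '' {γ : Conc A | ∃ δ : Conc B, ¬ δ.1 ≤ Q ∧
    (γ, δ) ∈ I.carrier}), Q, fun hle => ?_, hQ, ?_⟩
  · have hmem := CompactElements.mem_of_le_sSup
      (J := {γ : Conc A | ∃ δ : Conc B, ¬ δ.1 ≤ Q ∧ (γ, δ) ∈ I.carrier})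
      (fun _ _ hle ⟨δ, hδ, h⟩ => ⟨δ, hδ, I.lower (Prod.mk_le_mk.2 ⟨hle, le_rfl⟩) h⟩)
      ⟨δ₀, hQ, I.bot_left_mem _⟩
      (fun {x y} ⟨δ, hδ, hx⟩ ⟨δ', hδ', hy⟩ => by
        obtain ⟨ε, hε, hε', hεQ⟩ := hprime _ _ hδ hδ'
        exact ⟨ε, hεQ, I.sup_left_mem (I.lower (Prod.mk_le_mk.2 ⟨le_rfl, hε⟩) hx)
          (I.lower (Prod.mk_le_mk.2 ⟨le_rfl, hε'⟩) hy)⟩) hle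
    obtain ⟨δ, hδ, hγδ⟩ := hmem
    exact hδ (le_trans (le_sSup (Set.mem_image_of_mem (fun x : Conc B => x.1) hγδ)) hQ₀Q)
  · rintro ⟨γ, δ⟩ hγδ
    by_cases hδ : δ.1 ≤ Q
    · exact Or.inr hδ
    · exact Or.inl (le_sSup ⟨γ, ⟨δ, hδ, hγδ⟩, rfl⟩)

end BiIdeal

/-! ### Elementary intervals and the bi-ideal of a congruence -/

namespace BoxProduct

variable {A B : Type*} [Lattice A] [Lattice B]

theorem box_mono {a a' : A} {b b' : B} (ha : a ≤ a') (hb : b ≤ b') : box a b ≤ box a' b' :=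
  pureBox_mono ha hb

/-- The elementary interval above `a₀ □ b₀` spanned by `a₁` and `b₁`. -/
theorem box_le_inf {a₀ a₁ : A} {b₀ b₁ : B} (ha : a₀ ≤ a₁) (hb : b₀ ≤ b₁) :
    box a₀ b₀ ≤ box a₀ b₁ ⊓ box a₁ b₀ :=
  le_inf (box_mono le_rfl hb) (box_mono ha le_rfl)

theorem exists_finset (H : BoxProduct A B) :
    ∃ s : Finset (A × B), s.Nonempty ∧ ∀ q, q ∈ H.1 ↔ ∀ p ∈ s, q ∈ (box p.1 p.2).1 := by
  obtain ⟨_, s, hs, rfl⟩ := H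
  exact ⟨s, hs, fun q => by simp only [Set.mem_iInter]; rfl⟩

/-- Elements are intersections of pure boxes. Testing on boxes avoids computing the closures that
define joins. -/
theorem le_of_forall_le_box {H K : BoxProduct A B}
    (h : ∀ a b, H ≤ box a b → K ≤ box a b) : K ≤ H := by
  obtain ⟨s, hs, hH⟩ := H.exists_finset
  intro q hq
  refine (hH q).2 fun p hp => h _ _ (fun r hr => (hH r).1 hr p hp) hq

theorem box_inf_box_right (x y : A) (b : B) : box x b ⊓ box y b = box (x ⊓ y) b := by
  refine le_antisymm ?_ (le_inf (box_mono inf_le_left le_rfl) (box_mono inf_le_right le_rfl))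
  rintro q ⟨h₁ | h₁, h₂ | h₂⟩
  · exact Or.inl (le_inf h₁ h₂)
  all_goals exact Or.inr (by assumption)

theorem box_inf_box_left (a : A) (u v : B) : box a u ⊓ box a v = box a (u ⊓ v) := by
  refine le_antisymm ?_ (le_inf (box_mono le_rfl inf_le_left) (box_mono le_rfl inf_le_right))
  rintro q ⟨h₁ | h₁, h₂ | h₂⟩
  · exact Or.inl h₁
  · exact Or.inl h₁
  · exact Or.inl h₂
  · exact Or.inr (le_inf h₁ h₂)

variable [OrderTop A] [OrderTop B]

/-- The points `(a, ⊤)` and `(⊤, b)` of `box a b` test the inclusion, unless `c` or `d` is the unit;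
in that case `box c d` is all of A × B, which is the first alternative. -/
theorem box_le_box {a c : A} {b d : B} (h : box a b ≤ box c d) :
    (∀ K : BoxProduct A B, K ≤ box c d) ∨ (a ≤ c ∧ b ≤ d) := by
  by_cases hc : ⊤ ≤ c
  · exact Or.inl fun K q _ => Or.inl (le_top.trans hc)
  by_cases hd : ⊤ ≤ d
  · exact Or.inl fun K q _ => Or.inr (le_top.trans hd)
  have h₁ : (a, ⊤) ∈ (box c d).1 := h (Or.inl le_rfl)
  have h₂ : (⊤, b) ∈ (box c d).1 := h (Or.inr le_rfl)
  exact Or.inr ⟨h₁.resolve_right hd, h₂.resolve_left hc⟩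

/-- Joining with `box s u` carries an elementary interval to an elementary interval. The point `(y,
v)` lies in `box x v ⊓ box y u`, so a box `box c d` above the left side has `y ≤ c` or `v ≤ d`. -/
theorem box_sup_right {x y s : A} {u v : B} (hxs : x ≤ s) (huv : u ≤ v) :
    box s u ⊔ (box x v ⊓ box y u) = box s v ⊓ box (s ⊔ y) u := by
  refine le_antisymm (sup_le (box_le_inf le_sup_left huv)
    (inf_le_inf (box_mono hxs le_rfl) (box_mono le_sup_right le_rfl))) ?_
  refine le_of_forall_le_box fun c d h => ?_
  rcases box_le_box (le_sup_left.trans h) with h' | ⟨hsc, hud⟩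
  · exact h' _
  have : (y, v) ∈ (box c d).1 :=
    (le_sup_right.trans h : box x v ⊓ box y u ≤ box c d) ⟨Or.inr le_rfl, Or.inl le_rfl⟩
  rcases this with hyc | hvd
  · exact inf_le_right.trans (box_mono (sup_le hsc hyc) hud)
  · exact inf_le_left.trans (box_mono hsc hvd)

theorem box_sup_left {x y : A} {u v s : B} (hus : u ≤ s) (hxy : x ≤ y) :
    box x s ⊔ (box x v ⊓ box y u) = box x (s ⊔ v) ⊓ box y s := by
  refine le_antisymm (sup_le (box_le_inf hxy le_sup_left)
    (inf_le_inf (box_mono le_rfl le_sup_right) (box_mono le_rfl hus))) ?_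
  refine le_of_forall_le_box fun c d h => ?_
  rcases box_le_box (le_sup_left.trans h) with h' | ⟨hxc, hsd⟩
  · exact h' _
  have : (y, v) ∈ (box c d).1 :=
    (le_sup_right.trans h : box x v ⊓ box y u ≤ box c d) ⟨Or.inr le_rfl, Or.inl le_rfl⟩
  rcases this with hyc | hvd
  · exact inf_le_right.trans (box_mono hyc hsd)
  · exact inf_le_left.trans (box_mono hxc (sup_le hsd hvd))

/-- For `u ≤ v` and a congruence `C` of `A □ B`, the congruence of `A` of all pairs for which `C`
collapses the elementary interval spanned with `u` and `v`. -/
def leftCon (C : LatticeCon (BoxProduct A B)) {u v : B} (huv : u ≤ v) : LatticeCon A :=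
  haveI : Std.Refl fun x y : A =>
      C.r (box (x ⊓ y) u) (box (x ⊓ y) v ⊓ box (x ⊔ y) u) := ⟨fun x => by
    rw [inf_idem, sup_idem, inf_eq_right.2 (box_mono le_rfl huv)]⟩
  LatticeCon.mk' (fun x y : A => C.r (box (x ⊓ y) u) (box (x ⊓ y) v ⊓ box (x ⊔ y) u))
    (fun x y => by
      rw [inf_eq_left.2 (inf_le_sup : x ⊓ y ≤ x ⊔ y), sup_eq_right.2 (inf_le_sup : x ⊓ y ≤ x ⊔ y)])
    (fun x y z hxy hyz h₁ h₂ => by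
      rw [inf_eq_left.2 hxy, sup_eq_right.2 hxy] at h₁
      rw [inf_eq_left.2 hyz, sup_eq_right.2 hyz] at h₂
      rw [inf_eq_left.2 (hxy.trans hyz), sup_eq_right.2 (hxy.trans hyz)]
      -- The meet with `box x v` makes the second interval start where the first one ends.
      have h := C.rel_inf_right h₂ (box x v)
      have e : box y v ⊓ box z u ⊓ box x v = box x v ⊓ box z u := by
        rw [inf_right_comm, inf_eq_right.2 (box_mono hxy le_rfl)]
      rw [e, inf_comm] at h
      exact C.trans h₁ h)
    (fun x y t hxy h => by
      rw [inf_eq_left.2 hxy, sup_eq_right.2 hxy] at h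
      have h₁ := inf_le_inf_right t hxy
      have h₂ := sup_le_sup_right hxy t
      rw [inf_eq_left.2 h₁, inf_eq_left.2 h₂, sup_eq_right.2 h₁, sup_eq_right.2 h₂]
      constructor
      · have h' := C.rel_inf_right h (box t u)
        rw [inf_assoc, box_inf_box_right, box_inf_box_right] at h'
        have h'' := C.rel_inf_right h' (box (x ⊓ t) v)
        rw [inf_eq_left.2 (box_mono le_rfl huv), inf_right_comm,
          inf_eq_right.2 (box_mono inf_le_left le_rfl)] at h''
        exact h''
      · have h' := C.rel_sup_right h (box (x ⊔ t) u)
        rw [sup_eq_right.2 (box_mono le_sup_left le_rfl), sup_comm (box x v ⊓ box y u),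
          box_sup_right le_sup_left huv] at h'
        rwa [show x ⊔ t ⊔ y = y ⊔ t by
          rw [sup_right_comm, sup_eq_right.2 hxy]] at h')

theorem leftCon_rel {C : LatticeCon (BoxProduct A B)} {u v : B} {huv : u ≤ v} {x y : A} :
    (leftCon C huv).r x y ↔ C.r (box (x ⊓ y) u) (box (x ⊓ y) v ⊓ box (x ⊔ y) u) := Iff.rfl

/-- For `x ≤ y` and a congruence `C` of `A □ B`, the congruence of `B` of all pairs for which `C`
collapses the elementary interval spanned with `x` and `y`. -/
def rightCon (C : LatticeCon (BoxProduct A B)) {x y : A} (hxy : x ≤ y) : LatticeCon B :=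
  haveI : Std.Refl fun u v : B =>
      C.r (box x (u ⊓ v)) (box x (u ⊔ v) ⊓ box y (u ⊓ v)) := ⟨fun u => by
    rw [inf_idem, sup_idem, inf_eq_left.2 (box_mono hxy le_rfl)]⟩
  LatticeCon.mk' (fun u v : B => C.r (box x (u ⊓ v)) (box x (u ⊔ v) ⊓ box y (u ⊓ v)))
    (fun u v => by
      rw [inf_eq_left.2 (inf_le_sup : u ⊓ v ≤ u ⊔ v), sup_eq_right.2 (inf_le_sup : u ⊓ v ≤ u ⊔ v)])
    (fun u v w huv hvw h₁ h₂ => by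
      rw [inf_eq_left.2 huv, sup_eq_right.2 huv] at h₁
      rw [inf_eq_left.2 hvw, sup_eq_right.2 hvw] at h₂
      rw [inf_eq_left.2 (huv.trans hvw), sup_eq_right.2 (huv.trans hvw)]
      have h := C.rel_inf_right h₂ (box y u)
      have e : box x w ⊓ box y v ⊓ box y u = box x w ⊓ box y u := by
        rw [inf_assoc, inf_eq_right.2 (box_mono le_rfl huv)]
      rw [e] at h
      exact C.trans h₁ h)
    (fun u v t huv h => by
      rw [inf_eq_left.2 huv, sup_eq_right.2 huv] at h
      have h₁ := inf_le_inf_right t huv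
      have h₂ := sup_le_sup_right huv t
      rw [inf_eq_left.2 h₁, inf_eq_left.2 h₂, sup_eq_right.2 h₁, sup_eq_right.2 h₂]
      constructor
      · have h' := C.rel_inf_right h (box x t)
        rw [inf_right_comm, box_inf_box_left, box_inf_box_left] at h'
        have h'' := C.rel_inf_right h' (box y (u ⊓ t))
        rw [inf_eq_left.2 (box_mono hxy le_rfl), inf_assoc,
          inf_eq_right.2 (box_mono le_rfl inf_le_left)] at h''
        exact h''
      · have h' := C.rel_sup_right h (box x (u ⊔ t))
        rw [sup_eq_right.2 (box_mono le_rfl le_sup_left), sup_comm (box x v ⊓ box y u),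
          box_sup_left le_sup_left hxy] at h'
        rwa [show u ⊔ t ⊔ v = v ⊔ t by
          rw [sup_right_comm, sup_eq_right.2 huv]] at h')

theorem rightCon_rel {C : LatticeCon (BoxProduct A B)} {x y : A} {hxy : x ≤ y} {u v : B} :
    (rightCon C hxy).r u v ↔ C.r (box x (u ⊓ v)) (box x (u ⊔ v) ⊓ box y (u ⊓ v)) := Iff.rfl

theorem principal_le_leftCon {C : LatticeCon (BoxProduct A B)} {x y : A} {u v : B} (hxy : x ≤ y)
    {huv : u ≤ v} : LatticeCon.principal x y ≤ leftCon C huv ↔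
      C.r (box x u) (box x v ⊓ box y u) := by
  rw [LatticeCon.principal_le, leftCon_rel, inf_eq_left.2 hxy, sup_eq_right.2 hxy]

theorem principal_le_rightCon {C : LatticeCon (BoxProduct A B)} {x y : A} {u v : B} {hxy : x ≤ y}
    (huv : u ≤ v) : LatticeCon.principal u v ≤ rightCon C hxy ↔
      C.r (box x u) (box x v ⊓ box y u) := by
  rw [LatticeCon.principal_le, rightCon_rel, inf_eq_left.2 huv, sup_eq_right.2 huv]

/-- The bi-ideal of all pairs of congruences whose elementary intervals are collapsed by `C`. -/
def toBiIdeal (C : LatticeCon (BoxProduct A B)) : BiIdeal (Conc A) (Conc B) where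
  carrier := {p | ∀ (x y : A) (u v : B), x ≤ y → u ≤ v → p.1.1.r x y → p.2.1.r u v →
    C.r (box x u) (box x v ⊓ box y u)}
  bot_left_mem β x y u v hxy huv h _ :=
    (principal_le_leftCon (huv := huv) hxy).1 ((LatticeCon.principal_le.2 h).trans bot_le)
  bot_right_mem α x y u v hxy huv _ h :=
    (principal_le_rightCon (hxy := hxy) huv).1 ((LatticeCon.principal_le.2 h).trans bot_le)
  lower := fun _ _ hle h x y u v hxy huv h₁ h₂ => h x y u v hxy huv (hle.1 h₁) (hle.2 h₂)
  sup_left_mem := by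
    intro α α' β h h' x y u v hxy huv h₁ h₂
    refine (principal_le_leftCon (huv := huv) hxy).1 ((LatticeCon.principal_le.2 h₁).trans ?_)
    -- For fixed `u`, `v`, the congruence `leftCon` contains `α` and `α'`, hence their join.
    refine sup_le (a := α.1) (b := α'.1) ?_ ?_
    · exact LatticeCon.le_of_forall_le fun x y hxy hr => LatticeCon.principal_le.1 <|
        (principal_le_leftCon hxy).2 (h x y u v hxy huv hr h₂)
    · exact LatticeCon.le_of_forall_le fun x y hxy hr => LatticeCon.principal_le.1 <|
        (principal_le_leftCon hxy).2 (h' x y u v hxy huv hr h₂)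
  sup_right_mem := by
    intro α β β' h h' x y u v hxy huv h₁ h₂
    refine (principal_le_rightCon (hxy := hxy) huv).1 ((LatticeCon.principal_le.2 h₂).trans ?_)
    refine sup_le (a := β.1) (b := β'.1) ?_ ?_
    · exact LatticeCon.le_of_forall_le fun u v huv hr => LatticeCon.principal_le.1 <|
        (principal_le_rightCon huv).2 (h x y u v hxy huv h₁ hr)
    · exact LatticeCon.le_of_forall_le fun u v huv hr => LatticeCon.principal_le.1 <|
        (principal_le_rightCon huv).2 (h' x y u v hxy huv h₁ hr)

/-- One collapsed interval spreads to all pairs of the principal congruences: along A by `leftCon`,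
then along B by `rightCon`. -/
theorem principal_mem_toBiIdeal {C : LatticeCon (BoxProduct A B)} {x y : A} {u v : B}
    (hxy : x ≤ y) (huv : u ≤ v) :
    (Conc.principal x y, Conc.principal u v) ∈ (toBiIdeal C).carrier ↔
      C.r (box x u) (box x v ⊓ box y u) := by
  refine ⟨fun h => h x y u v hxy huv (LatticeCon.principal_rel _ _)
    (LatticeCon.principal_rel _ _), fun h x' y' u' v' hxy' huv' h₁ h₂ => ?_⟩
  have h' := (principal_le_leftCon (huv := huv) hxy').1
    ((LatticeCon.principal_le.2 h₁).trans ((principal_le_leftCon hxy).2 h))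
  exact (principal_le_rightCon (hxy := hxy') huv').1
    ((LatticeCon.principal_le.2 h₂).trans ((principal_le_rightCon huv).2 h'))

/-- Every interval above a pure box is a finite join of elementary intervals. -/
theorem exists_eq_sup'_of_box_le {a : A} {b : B} {K : BoxProduct A B} (hK : box a b ≤ K) :
    ∃ (s : Finset (A × B)) (hs : s.Nonempty), (∀ p ∈ s, a ≤ p.1 ∧ b ≤ p.2) ∧
      K = s.sup' hs fun p => box a p.2 ⊓ box p.1 b := by
  classical
  obtain ⟨s, -, hK'⟩ := K.exists_finset
  -- A point `q` of `K` lies in the piece indexed by the set `X` of those `p` with `q.1 ≤ p.1`. An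
  -- empty meet is the unit, so `X` may be empty or all of `s`.
  let f : Finset (A × B) → A × B := fun X => (a ⊔ X.inf Prod.fst, b ⊔ (s \ X).inf Prod.snd)
  refine ⟨s.powerset.image f, ⟨f s, Finset.mem_image_of_mem _ (by simp)⟩, ?_, le_antisymm ?_ ?_⟩
  · intro p hp
    obtain ⟨X, -, rfl⟩ := Finset.mem_image.1 hp
    exact ⟨le_sup_left, le_sup_left⟩
  · intro q hq
    have hq' := (hK' q).1 hq
    set X := s.filter fun p => q.1 ≤ p.1 with hX
    have hmem : f X ∈ s.powerset.image f :=
      Finset.mem_image_of_mem _ (by simp [hX, Finset.filter_subset])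
    refine (Finset.le_sup' (fun p : A × B => box a p.2 ⊓ box p.1 b) hmem :) ⟨Or.inr ?_, Or.inl ?_⟩
    · refine le_sup_of_le_right (Finset.le_inf fun p hp => ?_)
      rw [Finset.mem_sdiff] at hp
      exact (hq' p hp.1).resolve_left fun h => hp.2 (Finset.mem_filter.2 ⟨hp.1, h⟩)
    · exact le_sup_of_le_right (Finset.le_inf fun p hp => (Finset.mem_filter.1 hp).2)
  · refine Finset.sup'_le _ _ fun p hp => ?_
    obtain ⟨X, -, rfl⟩ := Finset.mem_image.1 hp
    intro q hq
    refine (hK' q).2 fun r hr => ?_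
    rcases box_le_box (show box a b ≤ box r.1 r.2 from fun z hz => (hK' z).1 (hK hz) r hr) with
      h | ⟨h₁, h₂⟩
    · exact h _ hq
    by_cases hrX : r ∈ X
    · exact (inf_le_right.trans (box_mono (sup_le h₁ (Finset.inf_le hrX)) h₂) :
        box a (f X).2 ⊓ box (f X).1 b ≤ box r.1 r.2) hq
    · exact (inf_le_left.trans (box_mono h₁
        (sup_le h₂ (Finset.inf_le (Finset.mem_sdiff.2 ⟨hr, hrX⟩)))) :
        box a (f X).2 ⊓ box (f X).1 b ≤ box r.1 r.2) hq

/-- For `H ≤ K`, joining with each box `p` of a representation of `H` gives intervals `[p, K ⊔ p]`,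
which are finite joins of elementary intervals. Meeting over `p` returns to an interval from `H` to
an element above `K`. -/
theorem toBiIdeal_le_toBiIdeal {C D : LatticeCon (BoxProduct A B)} :
    toBiIdeal C ≤ toBiIdeal D ↔ C ≤ D := by
  refine ⟨fun h => LatticeCon.le_of_forall_le fun H K hHK hC => ?_,
    fun h p hp x y u v hxy huv h₁ h₂ => h (hp x y u v hxy huv h₁ h₂)⟩
  have key : ∀ (a : A) (b : B) (K : BoxProduct A B), box a b ≤ K → C.r (box a b) K →
      D.r (box a b) K := by
    intro a b K hK hr
    obtain ⟨s, hs, hab, rfl⟩ := exists_eq_sup'_of_box_le hK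
    have : D.r (s.sup' hs fun _ => box a b) (s.sup' hs fun p => box a p.2 ⊓ box p.1 b) := by
      refine LatticeCon.sup'_rel D hs fun p hp => ?_
      obtain ⟨ha, hb⟩ := hab p hp
      refine (principal_mem_toBiIdeal ha hb).1 (h ((principal_mem_toBiIdeal ha hb).2 ?_))
      exact C.rel_of_le_of_le (box_le_inf ha hb)
        (Finset.le_sup' (fun p : A × B => box a p.2 ⊓ box p.1 b) hp) hr
    simpa using this
  obtain ⟨s, hs, hH⟩ := H.exists_finset
  have hHs : ∀ p ∈ s, H ≤ box p.1 p.2 := fun p hp q hq => (hH q).1 hq p hp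
  have hinf : H = s.inf' hs fun p => box p.1 p.2 := by
    refine le_antisymm (Finset.le_inf' _ _ hHs) fun q hq => (hH q).2 fun p hp => ?_
    exact (Finset.inf'_le (fun p : A × B => box p.1 p.2) hp :) hq
  have h₁ : D.r (s.inf' hs fun p => box p.1 p.2) (s.inf' hs fun p => K ⊔ box p.1 p.2) := by
    refine LatticeCon.inf'_rel D hs fun p hp => key _ _ _ le_sup_right ?_
    simpa [sup_eq_right.2 (hHs p hp)] using C.rel_sup_right hC (box p.1 p.2)
  rw [← hinf] at h₁
  exact D.rel_of_le_of_le hHK (Finset.le_inf' _ _ fun _ _ => le_sup_left) h₁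

end BoxProduct

/-! ### Congruences of the box product induced by pairs of congruences -/

namespace BoxProduct

variable {A B : Type*} [Lattice A] [Lattice B]

/-- The pairs congruent modulo `(P, Q)` to a pair whose pure box contains `H`. -/
def upperPairs (P : LatticeCon A) (Q : LatticeCon B) (H : BoxProduct A B) : Set (A × B) :=
  {p | ∃ c d, P.r c p.1 ∧ Q.r d p.2 ∧ H ≤ box c d}

variable {P : LatticeCon A} {Q : LatticeCon B}

theorem upperPairs_anti {H K : BoxProduct A B} (h : H ≤ K) :
    upperPairs P Q K ⊆ upperPairs P Q H :=
  fun _ ⟨c, d, hc, hd, hK⟩ => ⟨c, d, hc, hd, h.trans hK⟩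

theorem upperPairs_sup (H K : BoxProduct A B) :
    upperPairs P Q (H ⊔ K) = upperPairs P Q H ∩ upperPairs P Q K := by
  refine Set.Subset.antisymm
    (Set.subset_inter (upperPairs_anti le_sup_left) (upperPairs_anti le_sup_right)) ?_
  rintro p ⟨⟨c, d, hc, hd, hH⟩, ⟨c', d', hc', hd', hK⟩⟩
  refine ⟨c ⊔ c', d ⊔ d', ?_, ?_, sup_le (hH.trans (box_mono le_sup_left le_sup_left))
    (hK.trans (box_mono le_sup_right le_sup_right))⟩
  · simpa using P.sup hc hc'
  · simpa using Q.sup hd hd'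

variable [OrderTop A] [OrderTop B]

/-- It suffices to test inclusion of upper pairs on the boxes of one representation. -/
theorem upperPairs_subset {H K : BoxProduct A B} {s : Finset (A × B)}
    (hH : ∀ q, q ∈ H.1 ↔ ∀ p ∈ s, q ∈ (box p.1 p.2).1)
    (h : ∀ p ∈ s, p ∈ upperPairs P Q K) : upperPairs P Q H ⊆ upperPairs P Q K := by
  classical
  rintro ⟨a, b⟩ ⟨c, d, hca, hdb, hHcd⟩
  choose! f g hf hg hK using h
  -- `H ≤ box c d` says that for each `X ⊆ s` the meet of first coordinates over `X` is below `c`,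
  -- or that of second coordinates over the rest is below `d`. The congruent `c'`, `d'` keep these
  -- inequalities when each `p` is replaced by `(f p, g p)`, whose box contains `K`.
  obtain ⟨c', hc', hle⟩ := LatticeCon.exists_rel_le P s.powerset (fun X => X.inf Prod.fst)
    (fun X => X.inf f)
    (fun X hX => LatticeCon.inf_rel P X fun p hp => hf p (Finset.mem_powerset.1 hX hp)) c
  obtain ⟨d', hd', hle'⟩ := LatticeCon.exists_rel_le Q s.powerset (fun X => (s \ X).inf Prod.snd)
    (fun X => (s \ X).inf g)
    (fun X _ => LatticeCon.inf_rel Q _ fun p hp => hg p (Finset.mem_sdiff.1 hp).1) d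
  refine ⟨c', d', P.trans hc' hca, Q.trans hd' hdb, fun q hq => ?_⟩
  set X := s.filter fun p => q.1 ≤ f p with hX
  have hXs : X ∈ s.powerset := Finset.mem_powerset.2 (Finset.filter_subset _ _)
  have hmem : (X.inf Prod.fst, (s \ X).inf Prod.snd) ∈ (box c d).1 := by
    refine hHcd ((hH _).2 fun p hp => ?_)
    by_cases hpX : p ∈ X
    · exact Or.inl (Finset.inf_le hpX)
    · exact Or.inr (Finset.inf_le (Finset.mem_sdiff.2 ⟨hp, hpX⟩))
  rcases hmem with hc | hd
  · exact Or.inl ((Finset.le_inf fun p hp => (Finset.mem_filter.1 hp).2).trans (hle X hXs hc))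
  · refine Or.inr ((Finset.le_inf fun p hp => ?_).trans (hle' X hXs hd))
    rw [Finset.mem_sdiff] at hp
    exact (hK p hp.1 hq).resolve_left fun h => hp.2 (Finset.mem_filter.2 ⟨hp.1, h⟩)

/-- The boxes of `H` and `K` together represent `H ⊓ K`, so `upperPairs_subset` only has to test
boxes of one factor. -/
theorem upperPairs_inf_subset {H H' K K' : BoxProduct A B}
    (hH : upperPairs P Q H ⊆ upperPairs P Q H') (hK : upperPairs P Q K ⊆ upperPairs P Q K') :
    upperPairs P Q (H ⊓ K) ⊆ upperPairs P Q (H' ⊓ K') := by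
  classical
  obtain ⟨s, -, hs⟩ := H.exists_finset
  obtain ⟨t, -, ht⟩ := K.exists_finset
  refine upperPairs_subset (s := s ∪ t) (fun q => ?_) fun p hp => ?_
  · rw [coe_inf, Set.mem_inter_iff, hs, ht]
    simp only [Finset.mem_union, or_imp, forall_and]
  · rcases Finset.mem_union.1 hp with hp | hp
    · exact upperPairs_anti inf_le_left
        (hH ⟨p.1, p.2, P.refl _, Q.refl _, fun q hq => (hs q).1 hq p hp⟩)
    · exact upperPairs_anti inf_le_right
        (hK ⟨p.1, p.2, P.refl _, Q.refl _, fun q hq => (ht q).1 hq p hp⟩)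

/-- The congruence of `A □ B` induced by a congruence of `A` and a congruence of `B`. -/
def prodCon (P : LatticeCon A) (Q : LatticeCon B) : LatticeCon (BoxProduct A B) where
  toSetoid := Setoid.ker (upperPairs P Q)
  inf := fun h₁ h₂ => Set.Subset.antisymm
    (upperPairs_inf_subset (Eq.subset h₁) (Eq.subset h₂))
    (upperPairs_inf_subset (Eq.subset h₁.symm) (Eq.subset h₂.symm))
  sup := fun {w x y z} h₁ h₂ => by
    have h₁' : upperPairs P Q w = upperPairs P Q x := h₁
    have h₂' : upperPairs P Q y = upperPairs P Q z := h₂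
    show upperPairs P Q _ = upperPairs P Q _
    rw [upperPairs_sup, upperPairs_sup, h₁', h₂']

/-- If the interval is collapsed, some `box c d` with `c`, `d` congruent to `x`, `u` contains the
point `(y, v)`, and convexity of classes applies. Conversely, `box y u` or `box x v` is the required
box above the upper end. -/
theorem prodCon_rel {x y : A} {u v : B} (hxy : x ≤ y) (huv : u ≤ v) :
    (prodCon P Q).r (box x u) (box x v ⊓ box y u) ↔ P.r x y ∨ Q.r u v := by
  constructor
  · intro h
    have h' : upperPairs P Q (box x u) = upperPairs P Q (box x v ⊓ box y u) := h
    have hmem : (x, u) ∈ upperPairs P Q (box x v ⊓ box y u) :=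
      h' ▸ ⟨x, u, P.refl _, Q.refl _, le_rfl⟩
    obtain ⟨c, d, hc, hd, hle⟩ := hmem
    have : (y, v) ∈ (box c d).1 := hle ⟨Or.inr le_rfl, Or.inl le_rfl⟩
    rcases this with hyc | hvd
    · exact Or.inl (P.rel_of_le_of_le hxy hyc (P.symm hc))
    · exact Or.inr (Q.rel_of_le_of_le huv hvd (Q.symm hd))
  · intro h
    refine Set.Subset.antisymm (upperPairs_subset (s := {(x, u)}) (by simp) ?_)
      (upperPairs_anti (box_le_inf hxy huv))
    intro p hp
    obtain rfl := Finset.mem_singleton.1 hp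
    rcases h with h | h
    · exact ⟨y, u, P.symm h, Q.refl _, inf_le_right⟩
    · exact ⟨x, v, P.refl _, Q.symm h, inf_le_left⟩

/-- The preimage of `I` is the intersection of all `prodCon P Q` for which every pair in `I` is
below `P` or `Q` in its coordinate; separation shows that no further elementary interval is
collapsed. -/
theorem toBiIdeal_surjective :
    Function.Surjective (toBiIdeal : LatticeCon (BoxProduct A B) → BiIdeal (Conc A) (Conc B)) := by
  intro I
  let C : LatticeCon (BoxProduct A B) := sInf {D | ∃ (P : LatticeCon A) (Q : LatticeCon B),
    (∀ p ∈ I.carrier, p.1.1 ≤ P ∨ p.2.1 ≤ Q) ∧ D = prodCon P Q}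
  have key : ∀ (x y : A) (u v : B), x ≤ y → u ≤ v →
      (C.r (box x u) (box x v ⊓ box y u) ↔
        (Conc.principal x y, Conc.principal u v) ∈ I.carrier) := by
    intro x y u v hxy huv
    constructor
    · intro h
      by_contra hI
      obtain ⟨P, Q, hP, hQ, hPQ⟩ := BiIdeal.exists_separating hI
      rcases (prodCon_rel hxy huv).1 (h _ ⟨P, Q, hPQ, rfl⟩) with h | h
      · exact hP (LatticeCon.principal_le.2 h)
      · exact hQ (LatticeCon.principal_le.2 h)
    · rintro h _ ⟨P, Q, hPQ, rfl⟩
      exact (prodCon_rel hxy huv).2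
        ((hPQ _ h).imp LatticeCon.principal_le.1 LatticeCon.principal_le.1)
  refine ⟨C, le_antisymm (BiIdeal.le_of_forall_principal fun x y u v hxy huv h => ?_)
    (BiIdeal.le_of_forall_principal fun x y u v hxy huv h => ?_)⟩
  · exact (key x y u v hxy huv).1 ((principal_mem_toBiIdeal hxy huv).1 h)
  · exact (principal_mem_toBiIdeal hxy huv).2 ((key x y u v hxy huv).2 h)

/-- The congruences of `A □ B` correspond to the bi-ideals of `Con_c A × Con_c B`. -/
noncomputable def biIdealIso : LatticeCon (BoxProduct A B) ≃o BiIdeal (Conc A) (Conc B) :=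
  RelIso.ofSurjective (OrderEmbedding.ofMapLEIff toBiIdeal fun _ _ => toBiIdeal_le_toBiIdeal)
    toBiIdeal_surjective

/-- Both sides lie below the same congruences, namely those collapsing this interval. -/
theorem biIdealIso_symm_pure {x y : A} {u v : B} (hxy : x ≤ y) (huv : u ≤ v) :
    biIdealIso.symm (BiIdeal.pure (Conc.principal x y) (Conc.principal u v)) =
      LatticeCon.principal (box x u) (box x v ⊓ box y u) := by
  refine eq_of_forall_ge_iff fun C => ?_
  rw [OrderIso.symm_apply_le, BiIdeal.pure_le, LatticeCon.principal_le]
  exact principal_mem_toBiIdeal hxy huv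

end BoxProduct

/-! ### Restriction to compact elements, and uniqueness -/

namespace CompactElements

variable {α β : Type*} [CompleteLattice α] [CompleteLattice β]

theorem _root_.IsCompactElement.map_orderIso {k : α} (hk : IsCompactElement k) (e : α ≃o β) :
    IsCompactElement (e k) := by
  intro s u hne hdir hu hle
  obtain ⟨_, ⟨x, hx, rfl⟩, hkx⟩ := hk (e.symm '' s) (e.symm u) (hne.image _)
    (by
      rintro _ ⟨x, hx, rfl⟩ _ ⟨y, hy, rfl⟩
      obtain ⟨z, hz, hxz, hyz⟩ := hdir x hx y hy
      exact ⟨_, ⟨z, hz, rfl⟩, e.symm.monotone hxz, e.symm.monotone hyz⟩)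
    (e.symm.isLUB_image'.2 hu) (e.le_symm_apply.2 hle)
  exact ⟨x, hx, e.le_symm_apply.1 hkx⟩

/-- An isomorphism of complete lattices restricts to the compact elements. -/
def congr (e : α ≃o β) : CompactElements α ≃o CompactElements β where
  toFun k := ⟨e k.1, k.2.map_orderIso e⟩
  invFun k := ⟨e.symm k.1, k.2.map_orderIso e.symm⟩
  left_inv k := Subtype.ext (e.symm_apply_apply k.1)
  right_inv k := Subtype.ext (e.apply_symm_apply k.1)
  map_rel_iff' := e.map_rel_iff

end CompactElements

/-- Every element of `Con_c A ⊗ Con_c B` is the join of the pure tensors of principal congruences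
below it. -/
theorem SemilatticeTensor.isLUB_tmul_principal {A B : Type*} [Lattice A] [Lattice B]
    (t : SemilatticeTensor (Conc A) (Conc B)) :
    IsLUB {s | ∃ (x y : A) (u v : B), x ≤ y ∧ u ≤ v ∧
      s = tmul (Conc.principal x y) (Conc.principal u v) ∧ s ≤ t} t := by
  refine ⟨?_, fun w hw => ?_⟩
  · rintro _ ⟨x, y, u, v, -, -, -, h⟩
    exact h
  · refine BiIdeal.le_of_forall_principal (I := t.1) (J := w.1) fun x y u v hxy huv h => ?_
    exact BiIdeal.pure_le.1 (hw ⟨x, y, u, v, hxy, huv, rfl, BiIdeal.pure_le.2 h⟩)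

theorem mainTheorem5 {A : Type*} {B : Type*} [Lattice A] [OrderTop A] [Lattice B] [OrderTop B] :
    ∃! μ : SemilatticeTensor (Conc A) (Conc B) ≃o Conc (BoxProduct A B),
      ∀ (a₀ a₁ : A) (b₀ b₁ : B), a₀ ≤ a₁ → b₀ ≤ b₁ →
        μ (SemilatticeTensor.tmul (Conc.principal a₀ a₁) (Conc.principal b₀ b₁)) =
          Conc.principal (BoxProduct.box a₀ b₀)
            (BoxProduct.box a₀ b₁ ⊓ BoxProduct.box a₁ b₀) := by
  have hμ : ∀ (a₀ a₁ : A) (b₀ b₁ : B), a₀ ≤ a₁ → b₀ ≤ b₁ →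
      CompactElements.congr BoxProduct.biIdealIso.symm
        (SemilatticeTensor.tmul (Conc.principal a₀ a₁) (Conc.principal b₀ b₁)) =
      Conc.principal (BoxProduct.box a₀ b₀) (BoxProduct.box a₀ b₁ ⊓ BoxProduct.box a₁ b₀) :=
    fun a₀ a₁ b₀ b₁ ha hb => Subtype.ext (BoxProduct.biIdealIso_symm_pure ha hb)
  refine ⟨CompactElements.congr BoxProduct.biIdealIso.symm, hμ, fun ν hν => ?_⟩
  refine DFunLike.ext _ _ fun t => ?_
  -- Order isomorphisms preserve all existing suprema, so `ν` is determined by its values on the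
  -- pure tensors of principal congruences.
  have h := t.isLUB_tmul_principal
  refine (ν.isLUB_image'.2 h).unique ?_
  rw [Set.image_congr (g := CompactElements.congr BoxProduct.biIdealIso.symm)]
  · exact (OrderIso.isLUB_image' _).2 h
  · rintro _ ⟨x, y, u, v, hxy, huv, rfl, -⟩
    rw [hν x y u v hxy huv]
    exact (hμ x y u v hxy huv).symm
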